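/- The height of a polynomial with integer coefficients is the largest absolute value of its coefficients. For a positive integer $d$ let $A(d)$ denote the height of the $d$-th cyclotomic polynomial $\Phi_d$, and for a positive integer $n$ let $A_0(n) := \max_{d \mid n} A(d)$, the maximum being over the positive divisors $d$ of $n$. Let $\psi$ be a real-valued function defined on the positive integers such that $\psi(n) \to \infty$ as $n \to \infty$. Then $A_0(n) \le n^{\psi(n)}$ for almost all $n$, i.e., for all positive integers $n$ outside a set of asymptotic density $0$. -/

import Mathlib

/-- The height of an integer polynomial: the largest absolute value of its coefficients
(the zero polynomial has height `0`). -/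
def polyHeight (f : Polynomial ℤ) : ℕ :=
  f.support.sup (fun i => (f.coeff i).natAbs)

/-- `A(n)`: the height of the `n`-th cyclotomic polynomial. -/
noncomputable def cyclotomicHeight (n : ℕ) : ℕ :=
  polyHeight (Polynomial.cyclotomic n ℤ)

/-- `A₀(n)`: the maximum of `A(d)` over the positive divisors `d` of `n`. -/
noncomputable def maxCyclotomicHeight (n : ℕ) : ℕ :=
  n.divisors.sup cyclotomicHeight

open Classical in
/-- The set `S` of positive integers has asymptotic density `0`:
`#{n : 1 ≤ n ≤ x, n ∈ S} / x → 0` as `x → ∞` through the natural numbers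
(whether `0 ∈ S` is irrelevant). -/
def HasDensityZero (S : Set ℕ) : Prop :=
  Filter.Tendsto (fun x : ℕ => (((Finset.Icc 1 x).filter (fun n => n ∈ S)).card : ℝ) / (x : ℝ))
    Filter.atTop (nhds 0)

/-- The property `P` holds for almost all positive integers: it holds outside a set of
asymptotic density `0`. -/
def HoldsForAlmostAll (P : ℕ → Prop) : Prop :=
  HasDensityZero {n : ℕ | ¬ P n}

/-!
Write the prime factors of `n` as `p_1 > p_2 > ⋯` and let `W(n) = ∑ 2 ^ j * log p_j`
(`rankedLogSum n.primeFactors`). The proof has a deterministic and a statistical half.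

* `maxCyclotomicHeight_le`: `log A₀(n) ≤ W(n)`. When the primes of a squarefree number are adjoined
  in increasing order, each step `m ↦ m * p` squares a common bound for the coefficients of `Φ_m`
  and of the power series `1 / Φ_m`, up to a factor about `m`
  (`cyclotomic_prod_coeff_bound`). Passing from the radical to `n` does not change the height, and
  `W` is monotone under divisibility.
* `exists_card_mul_log_lt_rankedLogSum_le`: outside a set of small upper density, `W(n)` is
  `O(log x)` for `n ≤ x`. Typically `log p_j` is about `e ^ (-j) * log n` and `e > 2`, so the
  weights `2 ^ j` are affordable. The mean of `W` is too large for this, but for a small `α > 0` the moment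
  `∑_{n ≤ x} W(n) ^ α` is `O(x * (log x) ^ α)` (`exists_sum_rankedLogSum_rpow_le`). Indeed
  `W(n) ^ α ≤ ∑_{p ∣ n} (log p) ^ α * z ^ #{q ∣ n : q ≥ p}` with `z = 2 ^ α`; the mean of
  `z ^ #{q ∣ n : q > p}` is at most `∏_{p < q ≤ x} (1 + (z - 1) / q)`
  (`sum_prod_one_add_ite_dvd_le`), and only the Chebyshev upper bound `θ x ≤ log 4 * x` is needed to
  estimate this and the sum over `p`. Its constant is good enough because `log 4 * log 2 < 1`.

Hence `A₀(n) ≤ exp (K * log x) ≤ n ^ (2 * K)` for all `√x < n ≤ x` outside a set of at most `ε * x`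
elements, where `K` depends on `ε` only, and `2 * K ≤ ψ n` once `n` is large.
-/

/-! ### Coefficients of products with expanded polynomials -/

open Polynomial in
theorem coe_expand_powerSeries (p : ℕ) (hp : p ≠ 0) (f : ℤ[X]) :
    ((Polynomial.expand ℤ p f : ℤ[X]) : PowerSeries ℤ) =
      PowerSeries.expand p hp (f : PowerSeries ℤ) := by
  ext n
  rw [Polynomial.coeff_coe, Polynomial.coeff_expand (Nat.pos_of_ne_zero hp),
    PowerSeries.coeff_expand, Polynomial.coeff_coe]

theorem abs_coeff_expand_le {p : ℕ} (hp : p ≠ 0) {g : PowerSeries ℤ} {B : ℝ} (hB : 0 ≤ B)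
    (hg : ∀ k, |((g.coeff k : ℤ) : ℝ)| ≤ B) (k : ℕ) :
    |(((PowerSeries.expand p hp g).coeff k : ℤ) : ℝ)| ≤ B := by
  rw [PowerSeries.coeff_expand]
  split_ifs
  · exact hg _
  · simpa using hB

open Polynomial in
/-- The constant involves only the degree of `f`: it depends neither on `p` nor on how many
coefficients of `g` are nonzero. -/
theorem abs_coeff_expand_mul_le {p : ℕ} {f : ℤ[X]} {g : PowerSeries ℤ} {B : ℝ}
    (hB : 0 ≤ B) (hf : ∀ k, |((f.coeff k : ℤ) : ℝ)| ≤ B)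
    (hg : ∀ k, |((g.coeff k : ℤ) : ℝ)| ≤ B) (k : ℕ) :
    |((((Polynomial.expand ℤ p f : ℤ[X]) : PowerSeries ℤ) * g).coeff k : ℝ)| ≤
      (f.natDegree + 1) * B ^ 2 := by
  have h : ((Polynomial.expand ℤ p f : ℤ[X]) : PowerSeries ℤ) * g =
      ∑ i ∈ f.support, PowerSeries.C (f.coeff i) * (PowerSeries.X ^ (p * i) * g) := by
    rw [Polynomial.expand_eq_sum, Polynomial.sum_def, ← Polynomial.coeToPowerSeries.ringHom_apply,
      map_sum, Finset.sum_mul]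
    refine Finset.sum_congr rfl fun i _ => ?_
    rw [Polynomial.coeToPowerSeries.ringHom_apply, Polynomial.coe_mul, Polynomial.coe_C,
      Polynomial.coe_pow, Polynomial.coe_pow, Polynomial.coe_X, pow_mul, mul_assoc]
  rw [h, map_sum, Int.cast_sum]
  calc _ ≤ ∑ i ∈ f.support, B ^ 2 := by
        refine (Finset.abs_sum_le_sum_abs _ _).trans (Finset.sum_le_sum fun i _ => ?_)
        rw [PowerSeries.coeff_C_mul, PowerSeries.coeff_X_pow_mul', Int.cast_mul, abs_mul, sq]
        refine mul_le_mul (hf i) ?_ (abs_nonneg _) hB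
        split_ifs
        · exact hg _
        · simpa using hB
    _ = f.support.card * B ^ 2 := by simp
    _ ≤ _ := by
        gcongr
        exact_mod_cast Polynomial.card_supp_le_succ_natDegree f

/-! ### The weight of a set of primes -/

/-- The weight `∑ j, 2 ^ j * log p_j` of a finite set `p_1 > p_2 > ⋯` of natural numbers. The rank
`j` of an element `p` is encoded as the number of elements `≥ p`, so it starts at `1`. -/
noncomputable def rankedLogSum (s : Finset ℕ) : ℝ :=
  ∑ p ∈ s, 2 ^ (s.filter (p ≤ ·)).card * Real.log p

theorem rankedLogSum_mono {s t : Finset ℕ} (h : s ⊆ t) : rankedLogSum s ≤ rankedLogSum t := by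
  unfold rankedLogSum
  calc _ ≤ ∑ p ∈ s, 2 ^ (t.filter (p ≤ ·)).card * Real.log p := by
        refine Finset.sum_le_sum fun p _ => ?_
        gcongr
        norm_num
    _ ≤ _ := Finset.sum_le_sum_of_subset_of_nonneg h fun p _ _ =>
        mul_nonneg (by positivity) (Real.log_natCast_nonneg p)

theorem rankedLogSum_insert {s : Finset ℕ} {p : ℕ} (h : ∀ q ∈ s, q < p) :
    rankedLogSum (insert p s) = 2 * rankedLogSum s + 2 * Real.log p := by
  have hp : p ∉ s := fun hp => lt_irrefl _ (h p hp)
  unfold rankedLogSum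
  rw [Finset.sum_insert hp, add_comm, Finset.mul_sum]
  congr 1
  · refine Finset.sum_congr rfl fun q hq => ?_
    rw [Finset.filter_insert, if_pos (h q hq).le, Finset.card_insert_of_notMem (by simp [hp])]
    ring
  · have : (insert p s).filter (p ≤ ·) = {p} := by
      ext q
      simp only [Finset.mem_filter, Finset.mem_insert, Finset.mem_singleton]
      constructor
      · rintro ⟨rfl | hq, hpq⟩
        · rfl
        · exact absurd (h q hq) (by omega)
      · rintro rfl
        simp
    rw [this]
    simp

/-! ### Heights of cyclotomic polynomials -/

open Polynomial in
/-- The height bound for squarefree indices, proved together with the same bound for the inverse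
power series, by adjoining primes in increasing order. If `p ∤ m`, then
`Φ_{mp} = Φ_m(X ^ p) * Φ_m⁻¹` and `Φ_{mp}⁻¹ = Φ_m⁻¹(X ^ p) * Φ_m`, so a common bound `B` for the
coefficients at `m` becomes `(φ(m) + 1) * B ^ 2` at `m * p`. Dividing by the index in the bound
absorbs the factor `φ(m) + 1`. -/
theorem cyclotomic_prod_coeff_bound (s : Finset ℕ) (hs : ∀ p ∈ s, p.Prime) :
    ∃ g : PowerSeries ℤ, ((cyclotomic (∏ p ∈ s, p) ℤ : ℤ[X]) : PowerSeries ℤ) * g = 1 ∧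
      (∀ k, |(((cyclotomic (∏ p ∈ s, p) ℤ).coeff k : ℤ) : ℝ)| ≤
        Real.exp (rankedLogSum s - Real.log (∏ p ∈ s, p : ℕ))) ∧
      ∀ k, |((g.coeff k : ℤ) : ℝ)| ≤
        Real.exp (rankedLogSum s - Real.log (∏ p ∈ s, p : ℕ)) := by
  induction s using Finset.induction_on_max with
  | empty =>
    -- `Φ_1 = X - 1`, whose inverse is minus the geometric series.
    refine ⟨-PowerSeries.mk 1, ?_, fun k => ?_, fun k => ?_⟩
    · have := PowerSeries.mk_one_mul_one_sub_eq_one ℤ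
      simp only [Finset.prod_empty, cyclotomic_one, Polynomial.coe_sub, Polynomial.coe_X,
        Polynomial.coe_one]
      linear_combination this
    · rcases k with _ | _ | k <;>
        simp [rankedLogSum, Polynomial.coeff_X, Polynomial.coeff_one]
    · simp [rankedLogSum]
  | insert p s hlt ih =>
    have hpp : p.Prime := hs p (by simp)
    obtain ⟨g, hg, hfb, hgb⟩ := ih fun q hq => hs q (by simp [hq])
    have hps : p ∉ s := fun hp => lt_irrefl _ (hlt p hp)
    have hm : 0 < ∏ q ∈ s, q := Finset.prod_pos fun q hq => (hs q (by simp [hq])).pos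
    have hdvd : ¬ p ∣ ∏ q ∈ s, q := by
      rw [hpp.prime.dvd_finsetProd_iff]
      rintro ⟨q, hq, hpq⟩
      rw [Nat.prime_dvd_prime_iff_eq hpp (hs q (by simp [hq]))] at hpq
      exact hps (hpq ▸ hq)
    rw [Finset.prod_insert hps, mul_comm p, rankedLogSum_insert hlt]
    set m := ∏ q ∈ s, q
    set B := Real.exp (rankedLogSum s - Real.log (m : ℕ)) with hBdef
    have hB : 0 ≤ B := (Real.exp_pos _).le
    have hexp := congrArg (fun f : ℤ[X] => (f : PowerSeries ℤ))
      (cyclotomic_expand_eq_cyclotomic_mul hpp hdvd ℤ)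
    simp only [Polynomial.coe_mul] at hexp
    have hbound : ((cyclotomic m ℤ).natDegree + 1) * B ^ 2 ≤
        Real.exp (2 * rankedLogSum s + 2 * Real.log p - Real.log ((m * p : ℕ) : ℝ)) := by
      have hm0 : (0 : ℝ) < m := by exact_mod_cast hm
      have hp0 : (0 : ℝ) < p := by exact_mod_cast hpp.pos
      have : 2 * rankedLogSum s + 2 * Real.log p - Real.log ((m * p : ℕ) : ℝ) =
          (Real.log m + Real.log p) + ((rankedLogSum s - Real.log m) +
            (rankedLogSum s - Real.log m)) := by
        rw [Nat.cast_mul, Real.log_mul hm0.ne' hp0.ne']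
        ring
      rw [this, Real.exp_add, Real.exp_add _ (rankedLogSum s - _), ← hBdef, ← sq, Real.exp_add,
        Real.exp_log hm0, Real.exp_log hp0, natDegree_cyclotomic]
      gcongr
      have h1 : m.totient + 1 ≤ m * p := by
        have := Nat.totient_le m
        nlinarith [hpp.two_le]
      exact_mod_cast h1
    have hF : ((cyclotomic (m * p) ℤ : ℤ[X]) : PowerSeries ℤ) =
        ((Polynomial.expand ℤ p (cyclotomic m ℤ) : ℤ[X]) : PowerSeries ℤ) * g := by
      rw [hexp, mul_assoc, hg, mul_one]
    -- `expand ℤ 1` is the identity; it puts `Φ_m` in the shape that `abs_coeff_expand_mul_le`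
    -- expects of its sparse factor.
    refine ⟨((Polynomial.expand ℤ 1 (cyclotomic m ℤ) : ℤ[X]) : PowerSeries ℤ) *
      PowerSeries.expand p hpp.ne_zero g, ?_, fun k => ?_, fun k => ?_⟩
    · rw [Polynomial.expand_one, ← mul_assoc, ← hexp, coe_expand_powerSeries _ hpp.ne_zero,
        ← map_mul, hg, map_one]
    · rw [← Polynomial.coeff_coe, hF]
      exact (abs_coeff_expand_mul_le hB hfb hgb k).trans hbound
    · exact (abs_coeff_expand_mul_le hB hfb
        (abs_coeff_expand_le hpp.ne_zero hB hgb) k).trans hbound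

theorem polyHeight_le {f : Polynomial ℤ} {B : ℝ} (hB : 0 ≤ B)
    (h : ∀ k, |((f.coeff k : ℤ) : ℝ)| ≤ B) : (polyHeight f : ℝ) ≤ B := by
  rw [← Nat.le_floor_iff hB]
  refine Finset.sup_le fun i _ => ?_
  rw [Nat.le_floor_iff hB, Nat.cast_natAbs, Int.cast_abs]
  exact h i

open Polynomial in
/-- Reduces the height of a cyclotomic polynomial to the case of a squarefree index. -/
theorem expand_cyclotomic_of_primeFactors_subset {r k : ℕ} (hk : k ≠ 0)
    (h : k.primeFactors ⊆ r.primeFactors) :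
    Polynomial.expand ℤ k (cyclotomic r ℤ) = cyclotomic (r * k) ℤ := by
  induction k using induction_on_primes with
  | zero => exact absurd rfl hk
  | one => simp
  | prime_mul p a hp ih =>
    have ha : a ≠ 0 := by rintro rfl; simp at hk
    rw [Nat.primeFactors_mul hp.ne_zero ha] at h
    have hpr : p ∣ r := by
      apply Nat.dvd_of_mem_primeFactors (h _)
      simp [hp.primeFactors]
    rw [Polynomial.expand_mul, ih ha (Finset.subset_union_right.trans h),
      cyclotomic_expand_eq_cyclotomic hp (hpr.mul_right a)]
    congr 1
    ring

theorem cyclotomicHeight_le {n : ℕ} (hn : n ≠ 0) :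
    (cyclotomicHeight n : ℝ) ≤ Real.exp (rankedLogSum n.primeFactors) := by
  obtain ⟨g, -, hb, -⟩ := cyclotomic_prod_coeff_bound n.primeFactors
    fun p hp => Nat.prime_of_mem_primeFactors hp
  obtain ⟨k, hk⟩ := Nat.prod_primeFactors_dvd n
  set r := ∏ p ∈ n.primeFactors, p with hr
  have hk0 : k ≠ 0 := by rintro rfl; simp at hk; exact hn hk
  have hsub : k.primeFactors ⊆ r.primeFactors := by
    rw [hr, Nat.primeFactors_prod fun p hp => Nat.prime_of_mem_primeFactors hp]
    exact Nat.primeFactors_mono (Dvd.intro_left r hk.symm) hn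
  have hlog : 0 ≤ Real.log (r : ℝ) := Real.log_natCast_nonneg r
  refine polyHeight_le (Real.exp_pos _).le fun i => ?_
  rw [hk, ← expand_cyclotomic_of_primeFactors_subset hk0 hsub,
    Polynomial.coeff_expand (Nat.pos_of_ne_zero hk0)]
  rw [← hk]
  split_ifs
  · exact (hb _).trans (Real.exp_le_exp.2 (by linarith))
  · simpa using (Real.exp_pos _).le

theorem maxCyclotomicHeight_le {n : ℕ} (hn : n ≠ 0) :
    (maxCyclotomicHeight n : ℝ) ≤ Real.exp (rankedLogSum n.primeFactors) := by
  rw [← Nat.le_floor_iff (Real.exp_pos _).le]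
  refine Finset.sup_le fun d hd => ?_
  rw [Nat.le_floor_iff (Real.exp_pos _).le]
  have hd' := Nat.dvd_of_mem_divisors hd
  exact (cyclotomicHeight_le (ne_zero_of_dvd_ne_zero hn hd')).trans
    (Real.exp_le_exp.2 (rankedLogSum_mono (Nat.primeFactors_mono hd' hn)))

/-! ### Sums over primes -/

/-- Partial summation: an upper bound for the partial sums of `a`, with no lower bound, suffices
to sum `a` against a decreasing weight. -/
theorem sum_Ioc_mul_le_of_sum_le {a w : ℕ → ℝ} {κ : ℝ} (ha : ∀ n, 0 ≤ a n)
    (hA : ∀ N : ℕ, ∑ n ∈ Finset.Ioc 0 N, a n ≤ κ * N) {y x : ℕ} (hxy : y < x)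
    (hw0 : ∀ n, y < n → 0 ≤ w n) (hw : ∀ n, y < n → w (n + 1) ≤ w n) :
    ∑ n ∈ Finset.Ioc y x, a n * w n ≤
      κ * ((y + 1) * w (y + 1) + ∑ n ∈ Finset.Ioc (y + 1) x, w n) := by
  -- The extra boundary term is what makes the induction on `x` close.
  suffices h : ∑ n ∈ Finset.Ioc y x, a n * w n + (κ * x - ∑ n ∈ Finset.Ioc 0 x, a n) * w x ≤
      κ * ((y + 1) * w (y + 1) + ∑ n ∈ Finset.Ioc (y + 1) x, w n) by
    have := mul_nonneg (sub_nonneg.2 (hA x)) (hw0 x hxy)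
    linarith
  induction x, hxy using Nat.le_induction with
  | base =>
    have h1 : 0 ≤ (∑ n ∈ Finset.Ioc 0 y, a n) * w (y + 1) :=
      mul_nonneg (Finset.sum_nonneg fun n _ => ha n) (hw0 _ (Nat.lt_succ_self y))
    simp only [Nat.succ_eq_add_one]
    rw [Finset.sum_Ioc_succ_top (le_refl y), Finset.sum_Ioc_succ_top (Nat.zero_le y)]
    simp only [Finset.Ioc_self, Finset.sum_empty]
    push_cast
    linarith
  | succ x hyx ih =>
    simp only [Nat.succ_eq_add_one] at hyx
    have h1 := mul_nonneg (sub_nonneg.2 (hA x)) (sub_nonneg.2 (hw x hyx))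
    rw [Finset.sum_Ioc_succ_top (by omega), Finset.sum_Ioc_succ_top (Nat.zero_le x),
      Finset.sum_Ioc_succ_top (by omega : y + 1 ≤ x)]
    push_cast
    linarith

theorem sum_Ioc_le_sub {w F : ℕ → ℝ} {y x : ℕ} (hyx : y ≤ x)
    (h : ∀ n, y ≤ n → w (n + 1) ≤ F (n + 1) - F n) :
    ∑ n ∈ Finset.Ioc y x, w n ≤ F x - F y := by
  induction x, hyx using Nat.le_induction with
  | base => simp
  | succ x hyx ih =>
    rw [Finset.sum_Ioc_succ_top hyx]
    linarith [h x hyx]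

theorem sum_primes_log_mul_le {w F : ℕ → ℝ} {y x : ℕ} (hxy : y < x)
    (hw0 : ∀ n, y < n → 0 ≤ w n) (hw : ∀ n, y < n → w (n + 1) ≤ w n)
    (hF : ∀ n, y < n → w (n + 1) ≤ F (n + 1) - F n) :
    ∑ p ∈ Finset.Ioc y x with p.Prime, Real.log p * w p ≤
      Real.log 4 * ((y + 1) * w (y + 1) + (F x - F (y + 1))) := by
  have h := sum_Ioc_mul_le_of_sum_le (a := fun n => if n.Prime then Real.log n else 0)
    (κ := Real.log 4) (fun n => by split_ifs <;> simp [Real.log_natCast_nonneg])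
    (fun N => by
      have := Chebyshev.theta_le_log4_mul_x (Nat.cast_nonneg N : (0 : ℝ) ≤ N)
      rwa [Chebyshev.theta, Nat.floor_natCast, Finset.sum_filter] at this) hxy hw0 hw
  rw [Finset.sum_filter]
  simp only [ite_mul, zero_mul] at h
  refine h.trans ?_
  have h4 : 0 ≤ Real.log 4 := Real.log_nonneg (by norm_num)
  gcongr
  exact sum_Ioc_le_sub hxy hF

theorem log_natCast_pos_of_two_le {n : ℕ} (hn : 2 ≤ n) : 0 < Real.log n :=
  Real.log_pos (by exact_mod_cast hn)

theorem log_nat_le_log_succ_sub {n : ℕ} (hn : 1 ≤ n) :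
    Real.log n ≤ Real.log (n + 1 : ℕ) - 1 / (n + 1 : ℕ) := by
  have hn0 : (0 : ℝ) < n := by exact_mod_cast hn
  have h := Real.log_le_sub_one_of_pos (x := (n : ℝ) / (n + 1 : ℕ)) (by positivity)
  rw [Real.log_div (by positivity) (by positivity)] at h
  have : (n : ℝ) / (n + 1 : ℕ) - 1 = - (1 / (n + 1 : ℕ)) := by
    push_cast
    field_simp
    ring
  linarith

/-- Weak form of the second theorem of Mertens, with leading constant `log 4` in place of `1`, as
it follows from the Chebyshev bound `θ x ≤ log 4 * x`. -/
theorem sum_inv_primes_le {p x : ℕ} (hp : 2 ≤ p) (hpx : p ≤ x) :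
    ∑ q ∈ Finset.Ioc p x with q.Prime, (1 : ℝ) / q ≤
      Real.log 4 * (1 + (Real.log (Real.log x) - Real.log (Real.log p))) := by
  have h4 : 0 ≤ Real.log 4 := Real.log_nonneg (by norm_num)
  have hlp := log_natCast_pos_of_two_le hp
  rcases hpx.eq_or_lt with rfl | hlt
  · simpa using h4
  have h := sum_primes_log_mul_le (w := fun n => 1 / (n * Real.log n))
    (F := fun n => Real.log (Real.log n)) hlt
    (fun n hn => by
      have := Real.log_natCast_nonneg n
      positivity)
    (fun n hn => by
      have h1 := log_natCast_pos_of_two_le (n := n) (by omega)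
      have h2 : (0 : ℝ) < n := by exact_mod_cast (by omega : 0 < n)
      have h3 : (n : ℝ) ≤ (n + 1 : ℕ) := by push_cast; linarith
      gcongr)
    (fun n hn => by
      have h1 := log_natCast_pos_of_two_le (n := n) (by omega)
      have h1' := log_natCast_pos_of_two_le (n := n + 1) (by omega)
      have h2 := Real.log_le_sub_one_of_pos (div_pos h1 h1')
      rw [Real.log_div h1.ne' h1'.ne'] at h2
      have h3 := log_nat_le_log_succ_sub (n := n) (by omega)
      have h4 : Real.log n / Real.log (n + 1 : ℕ) ≤
          1 - 1 / ((n + 1 : ℕ) * Real.log (n + 1 : ℕ)) := by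
        rw [div_le_iff₀ h1', sub_mul, one_mul]
        have : 1 / (((n + 1 : ℕ) : ℝ) * Real.log (n + 1 : ℕ)) * Real.log (n + 1 : ℕ)
            = 1 / (n + 1 : ℕ) := by
          field_simp
        rw [this]
        exact h3
      linarith)
  calc _ = ∑ q ∈ Finset.Ioc p x with q.Prime, Real.log q * (1 / (q * Real.log q)) := by
        refine Finset.sum_congr rfl fun q hq => ?_
        have h1 := log_natCast_pos_of_two_le (Finset.mem_filter.1 hq).2.two_le
        field_simp
    _ ≤ _ := h
    _ ≤ _ := by
        have hl1 : 1 ≤ Real.log (p + 1 : ℕ) := by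
          rw [Real.le_log_iff_exp_le (by positivity)]
          have : (3 : ℝ) ≤ (p + 1 : ℕ) := by exact_mod_cast (by omega : 3 ≤ p + 1)
          linarith [Real.exp_one_lt_d9]
        have hmono : Real.log (Real.log p) ≤ Real.log (Real.log (p + 1 : ℕ)) := by
          have hp0 : (0 : ℝ) < p := by exact_mod_cast (by omega : 0 < p)
          have h3 : (p : ℝ) ≤ (p + 1 : ℕ) := by push_cast; linarith
          gcongr
        have hfirst : ((p : ℝ) + 1) * (1 / ((p + 1 : ℕ) * Real.log (p + 1 : ℕ))) ≤ 1 := by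
          have : ((p : ℝ) + 1) * (1 / ((p + 1 : ℕ) * Real.log (p + 1 : ℕ))) =
              1 / Real.log (p + 1 : ℕ) := by
            have : Real.log (p + 1 : ℕ) ≠ 0 := by positivity
            push_cast at this ⊢
            field_simp
          rw [this, div_le_one (by linarith)]
          exact hl1
        gcongr

theorem sum_primes_log_rpow_div_le {β : ℝ} (hβ : 0 < β) (hβ1 : β ≤ 1) {x : ℕ} (hx : 3 ≤ x) :
    ∑ p ∈ Finset.Ioc 1 x with p.Prime, Real.log p ^ β / p ≤
      Real.log 4 * (2 + 1 / β) * Real.log x ^ β := by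
  have h4 : 0 ≤ Real.log 4 := Real.log_nonneg (by norm_num)
  have h := sum_primes_log_mul_le (w := fun n => Real.log n ^ (β - 1) / n)
    (F := fun n => Real.log n ^ β / β) (y := 1) (x := x) (by omega)
    (fun n hn => by
      have := Real.log_natCast_nonneg n
      positivity)
    (fun n hn => by
      have h1 := log_natCast_pos_of_two_le (n := n) (by omega)
      have h2 : (0 : ℝ) < n := by exact_mod_cast (by omega : 0 < n)
      have h3 : (n : ℝ) ≤ (n + 1 : ℕ) := by push_cast; linarith
      have h5 : Real.log (n + 1 : ℕ) ^ (β - 1) ≤ Real.log n ^ (β - 1) :=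
        Real.rpow_le_rpow_of_nonpos h1 (Real.log_le_log h2 h3) (by linarith)
      gcongr)
    (fun n hn => by
      have h1 := log_natCast_pos_of_two_le (n := n) (by omega)
      have h1' := log_natCast_pos_of_two_le (n := n + 1) (by omega)
      have h3 := log_nat_le_log_succ_sub (n := n) (by omega)
      set b := Real.log n
      set a := Real.log (n + 1 : ℕ)
      -- Bernoulli gives `b ^ β ≤ a ^ β - β * a ^ (β - 1) * (a - b)`.
      have hB := rpow_one_add_le_one_add_mul_self (s := b / a - 1)
        (by linarith [div_pos h1 h1']) hβ.le hβ1
      rw [add_sub_cancel, Real.div_rpow h1.le h1'.le, div_le_iff₀ (by positivity)] at hB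
      have h6 : a ^ β = a ^ (β - 1) * a := by
        rw [← Real.rpow_add_one h1'.ne', sub_add_cancel]
      have h7 : (1 + β * (b / a - 1)) * a ^ β = a ^ β - β * (a ^ (β - 1) * (a - b)) := by
        rw [h6]
        field_simp
        ring
      have h8 : a ^ (β - 1) * (1 / (n + 1 : ℕ)) ≤ a ^ (β - 1) * (a - b) := by
        gcongr
        linarith
      rw [← sub_div, le_div_iff₀ hβ, div_eq_mul_one_div]
      nlinarith)
  have hlx : 1 ≤ Real.log x := by
    rw [Real.le_log_iff_exp_le (by positivity)]
    have : (3 : ℝ) ≤ x := by exact_mod_cast hx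
    linarith [Real.exp_one_lt_d9]
  calc _ = ∑ q ∈ Finset.Ioc 1 x with q.Prime, Real.log q * (Real.log q ^ (β - 1) / q) := by
        refine Finset.sum_congr rfl fun q hq => ?_
        have h1 := log_natCast_pos_of_two_le (Finset.mem_filter.1 hq).2.two_le
        rw [← mul_div_assoc, mul_comm (Real.log q), ← Real.rpow_add_one h1.ne', sub_add_cancel]
    _ ≤ _ := h
    _ ≤ _ := by
        rw [mul_assoc]
        refine mul_le_mul_of_nonneg_left ?_ h4
        have hl2 : (1 / 2 : ℝ) < Real.log 2 := by linarith [Real.log_two_gt_d9]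
        have h5 : Real.log 2 ^ (β - 1) ≤ 2 := by
          calc _ ≤ (1 / 2 : ℝ) ^ (β - 1) :=
                Real.rpow_le_rpow_of_nonpos (by norm_num) hl2.le (by linarith)
            _ ≤ (1 / 2 : ℝ) ^ (-1 : ℝ) :=
                Real.rpow_le_rpow_of_exponent_ge (by norm_num) (by norm_num) (by linarith)
            _ = 2 := by rw [Real.rpow_neg_one]; norm_num
        have h6 : 0 ≤ Real.log 2 ^ β / β := by positivity
        have h7 : 1 ≤ Real.log x ^ β := Real.one_le_rpow hlx hβ.le
        have h8 : (2 + 1 / β) * Real.log x ^ β = 2 * Real.log x ^ β + Real.log x ^ β / β := by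
          ring
        norm_num
        rw [← one_div, h8]
        linarith

/-! ### Mean values over integers -/

/-- A mean value bound without error term: expanding the product over subsets of `P` leaves only
nonnegative multiples of counts of multiples. -/
theorem sum_prod_one_add_ite_dvd_le (P : Finset ℕ) (hP : ∀ q ∈ P, q.Prime) {c : ℝ} (hc : 0 ≤ c)
    (N : ℕ) :
    ∑ m ∈ Finset.Ioc 0 N, ∏ q ∈ P, (1 + if q ∣ m then c else 0) ≤
      N * ∏ q ∈ P, (1 + c / q) := by
  simp_rw [Finset.prod_one_add]
  rw [Finset.sum_comm, Finset.mul_sum]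
  refine Finset.sum_le_sum fun t ht => ?_
  have htP := Finset.mem_powerset.1 ht
  calc _ ≤ ∑ m ∈ Finset.Ioc 0 N, if (∏ q ∈ t, q) ∣ m then c ^ t.card else 0 := by
        refine Finset.sum_le_sum fun m _ => ?_
        rw [Finset.prod_ite_zero]
        split_ifs with h1 h2 h2
        · simp
        · exact absurd (Finset.prod_primes_dvd m (fun q hq => (hP q (htP hq)).prime) h1) h2
        · positivity
        · rfl
    _ = ((N / ∏ q ∈ t, q : ℕ) : ℝ) * c ^ t.card := by
        rw [← Finset.sum_filter, Finset.sum_const, Nat.Ioc_filter_dvd_card_eq_div, nsmul_eq_mul]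
    _ ≤ (N / (∏ q ∈ t, q : ℕ)) * c ^ t.card := by
        gcongr
        exact Nat.cast_div_le
    _ = _ := by
        rw [Finset.prod_div_distrib, Finset.prod_const]
        push_cast
        ring

/-! ### Moments of the weight -/

theorem rpow_sum_le_sum_rpow {ι : Type*} (s : Finset ι) {f : ι → ℝ} (hf : ∀ i ∈ s, 0 ≤ f i)
    {α : ℝ} (hα : 0 < α) (hα1 : α ≤ 1) : (∑ i ∈ s, f i) ^ α ≤ ∑ i ∈ s, f i ^ α := by
  classical
  induction s using Finset.induction_on with
  | empty => simp [Real.zero_rpow hα.ne']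
  | insert i s hi ih =>
    rw [Finset.sum_insert hi, Finset.sum_insert hi]
    have h := ih fun j hj => hf j (Finset.mem_insert_of_mem hj)
    exact (Real.rpow_add_le_add_rpow (hf i (Finset.mem_insert_self i s))
      (Finset.sum_nonneg fun j hj => hf j (Finset.mem_insert_of_mem hj)) hα.le hα1).trans
        (by linarith)

theorem rankedLogSum_rpow_le (s : Finset ℕ) {α : ℝ} (hα : 0 < α) (hα1 : α ≤ 1) :
    rankedLogSum s ^ α ≤
      ∑ p ∈ s, Real.log p ^ α * ((2 : ℝ) ^ α) ^ (s.filter (p ≤ ·)).card := by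
  refine (rpow_sum_le_sum_rpow s (fun p _ =>
    mul_nonneg (by positivity) (Real.log_natCast_nonneg p)) hα hα1).trans (le_of_eq ?_)
  refine Finset.sum_congr rfl fun p _ => ?_
  rw [Real.mul_rpow (by positivity) (Real.log_natCast_nonneg p), mul_comm,
    ← Real.rpow_natCast_mul (by norm_num), ← Real.rpow_mul_natCast (by norm_num), mul_comm α]

theorem pow_card_primeFactors_filter_eq_prod (z : ℝ) (p : ℕ) {m x : ℕ} (hm : m ≠ 0) (hmx : m ≤ x) :
    z ^ (m.primeFactors.filter (p < ·)).card =
      ∏ q ∈ Finset.Ioc p x with q.Prime, (1 + if q ∣ m then z - 1 else 0) := by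
  have h : m.primeFactors.filter (p < ·) =
      ((Finset.Ioc p x).filter Nat.Prime).filter (· ∣ m) := by
    ext q
    simp only [Finset.mem_filter, Nat.mem_primeFactors, Finset.mem_Ioc]
    constructor
    · rintro ⟨⟨h1, h2, -⟩, h3⟩
      exact ⟨⟨⟨h3, (Nat.le_of_dvd (Nat.pos_of_ne_zero hm) h2).trans hmx⟩, h1⟩, h2⟩
    · rintro ⟨⟨⟨h1, -⟩, h2⟩, h3⟩
      exact ⟨⟨h2, h3, hm⟩, h1⟩
  rw [h, ← Finset.prod_const, Finset.prod_filter]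
  refine Finset.prod_congr rfl fun q _ => ?_
  split_ifs <;> ring

theorem sum_pow_card_primeFactors_filter_le {z : ℝ} (hz : 1 ≤ z) {p x N : ℕ} (hp : 2 ≤ p)
    (hpx : p ≤ x) (hN : N ≤ x) :
    ∑ m ∈ Finset.Ioc 0 N, z ^ (m.primeFactors.filter (p < ·)).card ≤
      N * (Real.exp (Real.log 4 * (z - 1)) *
        (Real.log x / Real.log p) ^ (Real.log 4 * (z - 1))) := by
  have hlp := log_natCast_pos_of_two_le hp
  have hlx := log_natCast_pos_of_two_le (hp.trans hpx)
  calc _ = ∑ m ∈ Finset.Ioc 0 N,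
        ∏ q ∈ Finset.Ioc p x with q.Prime, (1 + if q ∣ m then z - 1 else 0) := by
        refine Finset.sum_congr rfl fun m hm => ?_
        rw [Finset.mem_Ioc] at hm
        exact pow_card_primeFactors_filter_eq_prod z p (by omega) (by omega)
    _ ≤ N * ∏ q ∈ Finset.Ioc p x with q.Prime, (1 + (z - 1) / q) :=
        sum_prod_one_add_ite_dvd_le _ (fun q hq => (Finset.mem_filter.1 hq).2)
          (by linarith) N
    _ ≤ N * ∏ q ∈ Finset.Ioc p x with q.Prime, Real.exp ((z - 1) / q) := by
        refine mul_le_mul_of_nonneg_left (Finset.prod_le_prod (fun q _ => ?_) fun q _ => ?_)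
          (Nat.cast_nonneg N)
        · have : 0 ≤ (z - 1) / q := div_nonneg (by linarith) (Nat.cast_nonneg q)
          linarith
        rw [add_comm]
        exact Real.add_one_le_exp _
    _ = N * Real.exp ((z - 1) * ∑ q ∈ Finset.Ioc p x with q.Prime, (1 : ℝ) / q) := by
        rw [← Real.exp_sum, Finset.mul_sum]
        simp only [mul_one_div]
    _ ≤ N * Real.exp ((z - 1) *
          (Real.log 4 * (1 + (Real.log (Real.log x) - Real.log (Real.log p))))) := by
        gcongr
        exact sum_inv_primes_le hp hpx
    _ = _ := by
        rw [Real.rpow_def_of_pos (by positivity), Real.log_div hlx.ne' hlp.ne', ← Real.exp_add]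
        ring_nf

theorem sum_multiples_pow_card_primeFactors_filter_le {z : ℝ} (hz : 1 ≤ z) {p : ℕ} (hp : p.Prime)
    (x : ℕ) :
    ∑ n ∈ Finset.Ioc 0 x with p ∣ n, z ^ (n.primeFactors.filter (p ≤ ·)).card ≤
      z * ∑ m ∈ Finset.Ioc 0 (x / p), z ^ (m.primeFactors.filter (p < ·)).card := by
  have himg : (Finset.Ioc 0 x).filter (p ∣ ·) = (Finset.Ioc 0 (x / p)).image (p * ·) := by
    ext n
    simp only [Finset.mem_filter, Finset.mem_Ioc, Finset.mem_image]
    constructor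
    · rintro ⟨⟨h1, h2⟩, m, rfl⟩
      refine ⟨m, ⟨Nat.pos_of_mul_pos_left h1, ?_⟩, rfl⟩
      rw [Nat.le_div_iff_mul_le hp.pos]
      linarith
    · rintro ⟨m, ⟨h1, h2⟩, rfl⟩
      rw [Nat.le_div_iff_mul_le hp.pos] at h2
      exact ⟨⟨Nat.mul_pos hp.pos h1, by linarith⟩, dvd_mul_right _ _⟩
  rw [himg, Finset.sum_image fun a _ b _ h => Nat.eq_of_mul_eq_mul_left hp.pos h,
    Finset.mul_sum]
  refine Finset.sum_le_sum fun m hm => ?_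
  rw [← pow_succ']
  refine pow_le_pow_right₀ hz ((Finset.card_le_card ?_).trans
    (Finset.card_insert_le p (m.primeFactors.filter (p < ·))))
  intro q
  have hm0 : m ≠ 0 := by have := Finset.mem_Ioc.1 hm; omega
  rw [Nat.primeFactors_mul hp.ne_zero hm0, hp.primeFactors]
  simp only [Finset.mem_filter, Finset.mem_union, Finset.mem_singleton, Finset.mem_insert]
  rintro ⟨rfl | hq, hpq⟩
  · exact Or.inl rfl
  · rcases hpq.eq_or_lt with rfl | hlt
    · exact Or.inl rfl
    · exact Or.inr ⟨hq, hlt⟩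

/-- The `α`-th moment of the weight of a random `n ≤ x` is `O((log x) ^ α)`. After exchanging the
sums, a prime `p` contributes `(log p) ^ (α - γ) / p * (log x) ^ γ`, where
`γ = log 4 * (2 ^ α - 1)`, and the sum over `p` is of order `(log x) ^ α` exactly because the
exponent `α - γ` is positive. -/
theorem exists_sum_rankedLogSum_rpow_le {α : ℝ} (hα : 0 < α) (hα1 : α ≤ 1)
    (h : Real.log 4 * ((2 : ℝ) ^ α - 1) < α) :
    ∃ C : ℝ, ∀ x : ℕ, 3 ≤ x →
      ∑ n ∈ Finset.Ioc 0 x, rankedLogSum n.primeFactors ^ α ≤ C * x * Real.log x ^ α := by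
  set z : ℝ := 2 ^ α with hzdef
  have hz : 1 ≤ z := Real.one_le_rpow (by norm_num) hα.le
  set γ := Real.log 4 * (z - 1) with hγdef
  have hγ : 0 ≤ γ := mul_nonneg (Real.log_nonneg (by norm_num)) (by linarith)
  set β := α - γ with hβdef
  refine ⟨z * Real.exp γ * (Real.log 4 * (2 + 1 / β)), fun x hx => ?_⟩
  have hlx := log_natCast_pos_of_two_le (n := x) (by omega)
  calc _ ≤ ∑ n ∈ Finset.Ioc 0 x, ∑ p ∈ n.primeFactors,
          Real.log p ^ α * z ^ (n.primeFactors.filter (p ≤ ·)).card :=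
        Finset.sum_le_sum fun n _ => rankedLogSum_rpow_le _ hα hα1
    _ = ∑ p ∈ Finset.Ioc 1 x with p.Prime, ∑ n ∈ Finset.Ioc 0 x with p ∣ n,
          Real.log p ^ α * z ^ (n.primeFactors.filter (p ≤ ·)).card := by
        refine Finset.sum_comm' fun n p => ?_
        simp only [Finset.mem_filter, Finset.mem_Ioc, Nat.mem_primeFactors]
        constructor
        · rintro ⟨⟨h1, h2⟩, h3, h4, h5⟩
          exact ⟨⟨⟨h1, h2⟩, h4⟩, ⟨h3.one_lt, (Nat.le_of_dvd h1 h4).trans h2⟩, h3⟩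
        · rintro ⟨⟨⟨h1, h2⟩, h4⟩, -, h3⟩
          exact ⟨⟨h1, h2⟩, h3, h4, by omega⟩
    _ ≤ ∑ p ∈ Finset.Ioc 1 x with p.Prime,
          z * Real.exp γ * x * Real.log x ^ γ * (Real.log p ^ β / p) := by
        refine Finset.sum_le_sum fun p hp => ?_
        rw [Finset.mem_filter, Finset.mem_Ioc] at hp
        obtain ⟨⟨-, hpx⟩, hp⟩ := hp
        have hlp := log_natCast_pos_of_two_le hp.two_le
        rw [← Finset.mul_sum]
        calc _ ≤ Real.log p ^ α * (z * ((x / p : ℕ) * (Real.exp γ *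
                (Real.log x / Real.log p) ^ γ))) := by
              gcongr
              refine (sum_multiples_pow_card_primeFactors_filter_le hz hp x).trans ?_
              gcongr
              exact sum_pow_card_primeFactors_filter_le hz hp.two_le hpx (Nat.div_le_self x p)
          _ ≤ Real.log p ^ α * (z * ((x / p) * (Real.exp γ *
                (Real.log x / Real.log p) ^ γ))) := by
              gcongr
              exact Nat.cast_div_le
          _ = _ := by
              rw [Real.div_rpow hlx.le hlp.le, hβdef, Real.rpow_sub hlp]
              ring
    _ = z * Real.exp γ * x * Real.log x ^ γ *
          ∑ p ∈ Finset.Ioc 1 x with p.Prime, Real.log p ^ β / p := by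
        rw [Finset.mul_sum]
    _ ≤ z * Real.exp γ * x * Real.log x ^ γ *
          (Real.log 4 * (2 + 1 / β) * Real.log x ^ β) := by
        gcongr
        exact sum_primes_log_rpow_div_le (by linarith) (by linarith) hx
    _ = _ := by
        have : Real.log x ^ α = Real.log x ^ γ * Real.log x ^ β := by
          rw [← Real.rpow_add hlx, hβdef, add_sub_cancel]
        rw [this]
        ring

/-- As `α → 0`, `2 ^ α - 1 ~ α * log 2`, so a small `α` is admissible because
`log 4 * log 2 < 1`. -/
theorem log_four_mul_two_rpow_sub_one_lt :
    Real.log 4 * ((2 : ℝ) ^ (1 / 100 : ℝ) - 1) < 1 / 100 := by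
  have h4 : Real.log 4 = 2 * Real.log 2 := by
    rw [show (4 : ℝ) = 2 ^ 2 by norm_num, Real.log_pow]
    norm_num
  have h1 := Real.log_two_gt_d9
  have h2 := Real.log_two_lt_d9
  set t := Real.log 2 * (1 / 100) with ht
  have hexp := Real.abs_exp_sub_one_sub_id_le (x := t) (by rw [abs_le]; constructor <;> linarith)
  have hle := (abs_le.1 hexp).2
  rw [Real.rpow_def_of_pos (by norm_num), ← ht, h4]
  have hz : Real.exp t - 1 ≤ Real.log 2 * 0.01007 := by nlinarith
  nlinarith

theorem rankedLogSum_nonneg (s : Finset ℕ) : 0 ≤ rankedLogSum s :=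
  Finset.sum_nonneg fun p _ => mul_nonneg (by positivity) (Real.log_natCast_nonneg p)

/-- The Markov inequality for the `α`-th moment of the weight. -/
theorem exists_card_mul_log_lt_rankedLogSum_le {ε : ℝ} (hε : 0 < ε) :
    ∃ K : ℝ, 0 < K ∧ ∀ x : ℕ, 3 ≤ x →
      (((Finset.Ioc 0 x).filter
        fun n => K * Real.log x < rankedLogSum n.primeFactors).card : ℝ) ≤ ε * x := by
  obtain ⟨α, hα, hα1, hlt⟩ : ∃ α : ℝ, 0 < α ∧ α ≤ 1 ∧ Real.log 4 * ((2 : ℝ) ^ α - 1) < α :=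
    ⟨1 / 100, by norm_num, by norm_num, log_four_mul_two_rpow_sub_one_lt⟩
  obtain ⟨C, hC⟩ := exists_sum_rankedLogSum_rpow_le hα hα1 hlt
  obtain ⟨K, hKC, hK⟩ := (((tendsto_rpow_atTop hα).eventually_ge_atTop (C / ε)).and
    (Filter.eventually_gt_atTop 0)).exists
  refine ⟨K, hK, fun x hx => ?_⟩
  have hlx := log_natCast_pos_of_two_le (n := x) (by omega)
  have hlow : (((Finset.Ioc 0 x).filter
      fun n => K * Real.log x < rankedLogSum n.primeFactors).card : ℝ) *
        (K * Real.log x) ^ α ≤ C * x * Real.log x ^ α := by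
    calc _ = ∑ n ∈ Finset.Ioc 0 x with K * Real.log x < rankedLogSum n.primeFactors,
            (K * Real.log x) ^ α := by rw [Finset.sum_const, nsmul_eq_mul]
      _ ≤ ∑ n ∈ Finset.Ioc 0 x with K * Real.log x < rankedLogSum n.primeFactors,
            rankedLogSum n.primeFactors ^ α := Finset.sum_le_sum fun n hn =>
          Real.rpow_le_rpow (by positivity) (Finset.mem_filter.1 hn).2.le hα.le
      _ ≤ ∑ n ∈ Finset.Ioc 0 x, rankedLogSum n.primeFactors ^ α :=
          Finset.sum_le_sum_of_subset_of_nonneg (Finset.filter_subset _ _)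
            fun n _ _ => Real.rpow_nonneg (rankedLogSum_nonneg _) _
      _ ≤ _ := hC x hx
  rw [Real.mul_rpow hK.le hlx.le, ← mul_assoc] at hlow
  have h1 := le_of_mul_le_mul_right hlow (by positivity)
  have hKpos : 0 < K ^ α := by positivity
  rw [div_le_iff₀ hε] at hKC
  refine le_of_mul_le_mul_right (h1.trans ?_) hKpos
  calc C * x ≤ (K ^ α * ε) * x := by gcongr
    _ = _ := by ring

/-! ### Almost all integers -/

theorem proposition2p1 (ψ : ℕ → ℝ) (hψ : Filter.Tendsto ψ Filter.atTop Filter.atTop) :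
    HoldsForAlmostAll (fun n : ℕ => (maxCyclotomicHeight n : ℝ) ≤ (n : ℝ) ^ ψ n) := by
  classical
  unfold HoldsForAlmostAll HasDensityZero
  rw [Metric.tendsto_atTop]
  intro ε hε
  obtain ⟨K, hK, hcard⟩ := exists_card_mul_log_lt_rankedLogSum_le (half_pos hε)
  obtain ⟨N₀, hN₀⟩ := Filter.eventually_atTop.1 (hψ.eventually_ge_atTop (2 * K))
  obtain ⟨M, hM⟩ := exists_nat_gt (2 / ε)
  refine ⟨max 3 (max (N₀ ^ 2) (M ^ 2)), fun x hx => ?_⟩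
  simp only [max_le_iff, ge_iff_le] at hx
  obtain ⟨hx3, hxN, hxM⟩ := hx
  have hx0 : (0 : ℝ) < x := by exact_mod_cast (by omega : 0 < x)
  set A := Finset.Ioc 0 x.sqrt
  set B := (Finset.Ioc 0 x).filter fun n => K * Real.log x < rankedLogSum n.primeFactors
  -- An `n > √x` satisfies `log x ≤ 2 * log n`, so it is bad only if its weight is large.
  have hsub : ∀ n, 1 ≤ n → n ≤ x → ¬ (maxCyclotomicHeight n : ℝ) ≤ (n : ℝ) ^ ψ n →
      n ∈ A ∪ B := by
    intro n hn1 hnx hbad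
    simp only [A, B, Finset.mem_union, Finset.mem_Ioc, Finset.mem_filter]
    by_contra! hcon
    have hsq : x.sqrt < n := hcon.1 (by omega)
    have hW : rankedLogSum n.primeFactors ≤ K * Real.log x := hcon.2 ⟨by omega, hnx⟩
    have hxn : x ≤ n ^ 2 := by
      rw [sq]
      exact (Nat.sqrt_lt.1 hsq).le
    have hnN : N₀ ≤ n := (Nat.le_sqrt'.2 hxN).trans hsq.le
    have hn0 : (0 : ℝ) < n := by exact_mod_cast hn1
    have hlog : Real.log x ≤ 2 * Real.log n := by
      have : Real.log x ≤ Real.log ((n : ℝ) ^ 2) :=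
        Real.log_le_log hx0 (by exact_mod_cast hxn)
      rwa [Real.log_pow, Nat.cast_ofNat] at this
    refine hbad ((maxCyclotomicHeight_le (by omega)).trans ?_)
    rw [Real.rpow_def_of_pos hn0, Real.exp_le_exp]
    calc _ ≤ K * Real.log x := hW
      _ ≤ K * (2 * Real.log n) := by gcongr
      _ = Real.log n * (2 * K) := by ring
      _ ≤ Real.log n * ψ n := by
        gcongr
        exact hN₀ n hnN
  have hsqrt : (x.sqrt : ℝ) < ε / 2 * x := by
    have h1 : (M : ℝ) ≤ x.sqrt := by exact_mod_cast Nat.le_sqrt'.2 hxM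
    have h2 : (x.sqrt : ℝ) * x.sqrt ≤ x := by exact_mod_cast Nat.sqrt_le x
    have h3 : 2 / ε < x.sqrt := hM.trans_le h1
    rw [div_lt_iff₀ hε] at h3
    have h4 : (0 : ℝ) < x.sqrt := by
      exact_mod_cast Nat.sqrt_pos.2 (by omega : 0 < x)
    nlinarith
  rw [Real.dist_eq, sub_zero, abs_of_nonneg (by positivity), div_lt_iff₀ hx0]
  have hB : (B.card : ℝ) ≤ ε / 2 * x := hcard x hx3
  have hA : (A.card : ℝ) = x.sqrt := by simp [A]
  have hAB : ((A.card + B.card : ℕ) : ℝ) < ε * x := by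
    push_cast
    linarith
  refine lt_of_le_of_lt (Nat.cast_le.2 ((Finset.card_le_card fun n hn => ?_).trans
    (Finset.card_union_le A B))) hAB
  simp only [Finset.mem_filter, Finset.mem_Icc] at hn
  exact hsub n hn.1.1 hn.1.2 hn.2
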